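/- A partial ranking (bucket order) of $[n]=\{1,\dots,n\}$ is a map $\sigma:[n]\to[n]$ whose image is $\{1,\dots,t\}$ for some $t$; $\sigma(x)$ is the index of the bucket of $x$, and $x,y$ are tied if $\sigma(x)=\sigma(y)$. The Kemeny distance is $$d_K(\pi,\sigma)=|\{(x,y):\pi(x)>\pi(y),\ \sigma(x)<\sigma(y)\}|+\tfrac12\,|\{(x,y):\pi(x)=\pi(y),\,\sigma(x)>\sigma(y)\ \text{ or }\ \pi(x)>\pi(y),\,\sigma(x)=\sigma(y)\}|.$$ For a partial ranking $\sigma_0$ of $[n]$ and $\phi\in(0,1]$, the generalized Mallows model $\mathrm{GMM}(\sigma_0,\phi)$ is the probability distribution on the set of all partial rankings of $[n]$ in which $\sigma$ has probability proportional to $\phi^{d_K(\sigma_0,\sigma)}$. The median-based Lehmer code aggregator (LCA) takes partial rankings $\sigma_1,\dots,\sigma_m$ of $[n]$ and returns a permutation of $[n]$ as follows. For a partial ranking $\sigma$ and $x\in[n]$ put $c_\sigma(x)=|\{y<x:\sigma(y)>\sigma(x)\}|$ and $c'_\sigma(x)=|\{y<x:\sigma(y)\ge\sigma(x)\}|$.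 The vote of $\sigma_k$ for placing $x$ at position $y\in[x]$ among the elements $1,\dots,x$ is $v_{k\to x}(y)=\frac{1}{c'_{\sigma_k}(x)-c_{\sigma_k}(x)+1}$ if $x-c'_{\sigma_k}(x)\le y\le x-c_{\sigma_k}(x)$, and $0$ otherwise. Let $V_x(y)=\sum_{k=1}^m v_{k\to x}(y)$, let $p(x)=\min\{j:\frac1m\sum_{y=1}^{j}V_x(y)\ge\frac12\}$ be the median position, and let $\hat c(x)=x-p(x)$. The output is the permutation $\hat\sigma$ whose Lehmer code is $\hat c$, that is, the unique permutation with $|\{y<x:\hat\sigma(y)>\hat\sigma(x)\}|=\hat c(x)$ for all $x\in[n]$. **Theorem.** Let $\sigma_0$ be a partial ranking of $[n]$, let $0<\phi$ with $\phi+\phi^{1/2}<1$, let $\delta>0$, and let $\sigma_1,\dots,\sigma_m$ be i.i.d. with distribution $\mathrm{GMM}(\sigma_0,\phi)$. Put $q'=1-\frac12\phi^{1/2}-\frac12\phi$. If $$m\ \ge\ \frac{2}{(1-2q')^2}\,\log\frac{2n}{\delta},$$ then, with probability at least $1-\delta$, the output $\hat\sigma$ of the median-based LCA on $\sigma_1,\dots,\sigma_m$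 belongs to $\Sigma_0$, the set of permutations obtained by breaking the ties of $\sigma_0$, i.e. the permutations $\tau$ of $[n]$ such that $\sigma_0(x)<\sigma_0(y)$ implies $\tau(x)<\tau(y)$. -/

import Mathlib

open MeasureTheory ProbabilityTheory
open scoped Finset

/-! Elements, bucket indices and positions are counted from `0`: the element `x : Fin n` is the
element `x + 1` of `{1, …, n}`, and similarly for buckets and positions. -/

/-- `f x` is the index of the bucket of `x`; the buckets in use are `0, …, t - 1` for some `t`. -/
def IsBucketOrder {n : ℕ} (f : Fin n → Fin n) : Prop :=
  ∀ x, ∀ b < f x, ∃ y, f y = b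

instance {n : ℕ} : DecidablePred (IsBucketOrder (n := n)) := fun f => by
  unfold IsBucketOrder; infer_instance

/-- Partial rankings (bucket orders) of `n` elements, each given by its bucket-index map. Elements
in buckets of smaller index are ranked higher; elements of one bucket are tied. -/
abbrev PartialRanking (n : ℕ) : Type := {f : Fin n → Fin n // IsBucketOrder f}

/-- The Kemeny distance: the number of pairs ranked in opposite ways, plus half the number of pairs
tied in exactly one of the two rankings. -/
noncomputable def kemenyDist {n : ℕ} (π σ : PartialRanking n) : ℝ :=
  (#{p : Fin n × Fin n | π.1 p.1 > π.1 p.2 ∧ σ.1 p.1 < σ.1 p.2} : ℝ) +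
    1 / 2 * (#{p : Fin n × Fin n | (π.1 p.1 = π.1 p.2 ∧ σ.1 p.1 > σ.1 p.2) ∨
      (π.1 p.1 > π.1 p.2 ∧ σ.1 p.1 = σ.1 p.2)} : ℝ)

/-- The probability of `σ` under the generalized Mallows model with centroid `σ₀`. -/
noncomputable def gmmProb {n : ℕ} (σ₀ : PartialRanking n) (φ : ℝ) (σ : PartialRanking n) : ℝ :=
  φ ^ kemenyDist σ₀ σ / ∑ ρ : PartialRanking n, φ ^ kemenyDist σ₀ ρ

/-- The generalized Mallows model `GMM(σ₀, φ)` as a measure on the partial rankings. -/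
noncomputable def gmm {n : ℕ} (σ₀ : PartialRanking n) (φ : ℝ) : Measure (PartialRanking n) :=
  ∑ σ : PartialRanking n, ENNReal.ofReal (gmmProb σ₀ φ σ) • Measure.dirac σ

/-- `c_f(x) = |{y < x : f y > f x}|`. -/
def strictCode {n : ℕ} (f : Fin n → Fin n) (x : Fin n) : ℕ :=
  #{y : Fin n | y < x ∧ f y > f x}

/-- `c'_f(x) = |{y < x : f y ≥ f x}|`. -/
def weakCode {n : ℕ} (f : Fin n → Fin n) (x : Fin n) : ℕ :=
  #{y : Fin n | y < x ∧ f y ≥ f x}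

theorem strictCode_lt {n : ℕ} (f : Fin n → Fin n) (x : Fin n) : strictCode f x < (x : ℕ) + 1 := by
  have h : strictCode f x ≤ #(Finset.Iio x) :=
    Finset.card_le_card fun y hy => by
      simp only [Finset.mem_filter, Finset.mem_univ, true_and] at hy
      exact Finset.mem_Iio.2 hy.1
  rw [Fin.card_Iio] at h
  omega

/-- The Lehmer code of a permutation; `τ x` is the position of the element `x`. -/
def lehmerCode {n : ℕ} (τ : Equiv.Perm (Fin n)) (x : Fin n) : Fin ((x : ℕ) + 1) :=
  ⟨strictCode τ x, strictCode_lt τ x⟩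

theorem lt_iff_card_le_strictCode {n : ℕ} (τ : Equiv.Perm (Fin n)) {t y : Fin n} (hy : y < t) :
    τ t < τ y ↔ #{z : Fin n | z < t ∧ τ y ≤ τ z} ≤ strictCode τ t := by
  constructor
  · intro h
    refine Finset.card_le_card fun z hz => ?_
    simp only [Finset.mem_filter, Finset.mem_univ, true_and] at hz ⊢
    exact ⟨hz.1, h.trans_le hz.2⟩
  · intro h
    by_contra hlt
    rw [not_lt] at hlt
    have hne : τ y ≠ τ t := fun e => hy.ne (τ.injective e)
    refine absurd h (not_le.2 (Finset.card_lt_card ?_))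
    refine Finset.ssubset_iff_of_subset (fun z hz => ?_) |>.2 ⟨y, ?_, ?_⟩
    · simp only [Finset.mem_filter, Finset.mem_univ, true_and] at hz ⊢
      exact ⟨hz.1, hlt.trans hz.2.le⟩
    · simp [hy]
    · simp [hlt]

theorem lehmerCode_injective (n : ℕ) : Function.Injective (lehmerCode (n := n)) := by
  intro τ τ' h
  have hc : ∀ x, strictCode τ x = strictCode τ' x := fun x =>
    congrArg Fin.val (congrFun h x)
  have key : ∀ t : ℕ, ∀ x y : Fin n, (x : ℕ) < t → (y : ℕ) < t → (τ x < τ y ↔ τ' x < τ' y) := by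
    intro t
    induction t with
    | zero => intro x y hx; omega
    | succ t ih =>
      have step : ∀ x y : Fin n, (x : ℕ) = t → (y : ℕ) < t → (τ x < τ y ↔ τ' x < τ' y) := by
        intro x y hx hy
        have hyx : y < x := Fin.lt_def.2 (by omega)
        rw [lt_iff_card_le_strictCode τ hyx, lt_iff_card_le_strictCode τ' hyx, hc x]
        have e : ({z : Fin n | z < x ∧ τ y ≤ τ z} : Finset (Fin n)) =
            ({z : Fin n | z < x ∧ τ' y ≤ τ' z} : Finset (Fin n)) := by
          refine Finset.filter_congr fun z _ => and_congr_right fun hz => ?_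
          have hz' : (z : ℕ) < t := by have := Fin.lt_def.1 hz; omega
          have := ih z y hz' hy
          rw [← not_lt, ← not_lt, this]
        rw [e]
      intro x y hx hy
      rcases Nat.lt_succ_iff_lt_or_eq.1 hx with hx' | hx' <;>
        rcases Nat.lt_succ_iff_lt_or_eq.1 hy with hy' | hy'
      · exact ih x y hx' hy'
      · have hxy : x ≠ y := fun e => by subst e; omega
        have h1 : τ x ≠ τ y := τ.injective.ne hxy
        have h2 : τ' x ≠ τ' y := τ'.injective.ne hxy
        have := step y x hy' hx'
        rw [← not_le, ← not_le, h1.symm.le_iff_lt, h2.symm.le_iff_lt, this]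
      · exact step x y hx' hy'
      · have : x = y := Fin.ext (by omega)
        subst this
        simp
  have mono : StrictMono (τ' ∘ τ.symm) := by
    intro a b hab
    have := (key n (τ.symm a) (τ.symm b) (Fin.is_lt _) (Fin.is_lt _)).1
    simpa using this (by simpa using hab)
  have e : (τ' ∘ τ.symm : Fin n → Fin n) = id :=
    (mono.range_inj strictMono_id).1 (by
      rw [(τ'.surjective.comp τ.symm.surjective).range_eq, Set.range_id])
  ext x
  have := congrFun e (τ x)
  simp only [Function.comp_apply, Equiv.symm_apply_apply, id] at this
  rw [this]

theorem lehmerCode_bijective (n : ℕ) : Function.Bijective (lehmerCode (n := n)) := by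
  rw [Fintype.bijective_iff_injective_and_card]
  refine ⟨lehmerCode_injective n, ?_⟩
  rw [Fintype.card_perm, Fintype.card_fin, Fintype.card_pi]
  simp only [Fintype.card_fin]
  rw [Fin.prod_univ_eq_prod_range (fun i => i + 1) n, Finset.prod_range_add_one_eq_factorial]

/-- The inverse Lehmer code: the permutation with a given Lehmer code. -/
noncomputable def lehmerDecode {n : ℕ} (c : (x : Fin n) → Fin ((x : ℕ) + 1)) :
    Equiv.Perm (Fin n) :=
  (Equiv.ofBijective lehmerCode (lehmerCode_bijective n)).symm c

/-- The (fractional) vote of the partial ranking `σ` for placing `x` at position `y` among the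
elements `0, …, x`: uniform on the positions that `x` may take there. -/
noncomputable def vote {n : ℕ} (σ : PartialRanking n) (x : Fin n) (y : ℕ) : ℝ :=
  if y ∈ Finset.Icc ((x : ℕ) - weakCode σ.1 x) ((x : ℕ) - strictCode σ.1 x) then
    1 / ((weakCode σ.1 x : ℝ) - (strictCode σ.1 x : ℝ) + 1)
  else 0

/-- The total vote of the sample for placing `x` at position `y` among `0, …, x`. -/
noncomputable def totalVote {n m : ℕ} (σ : Fin m → PartialRanking n) (x : Fin n) (y : ℕ) : ℝ :=
  ∑ k, vote (σ k) x y

/-- The median position of `x` among `0, …, x`: the least position up to which at least half of the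
votes are cast. -/
noncomputable def medianPosition {n m : ℕ} (σ : Fin m → PartialRanking n) (x : Fin n) : ℕ :=
  sInf {j : ℕ | 1 / 2 ≤ (∑ y ∈ Finset.range (j + 1), totalVote σ x y) / (m : ℝ)}

/-- The aggregated Lehmer code: `x` is to be placed at its median position among `0, …, x`. -/
noncomputable def medianCode {n m : ℕ} (σ : Fin m → PartialRanking n) (x : Fin n) :
    Fin ((x : ℕ) + 1) :=
  ⟨(x : ℕ) - medianPosition σ x, by omega⟩

/-- The Lehmer code aggregator for partial rankings, with the median rule. -/
noncomputable def lcaMedian {n m : ℕ} (σ : Fin m → PartialRanking n) : Equiv.Perm (Fin n) :=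
  lehmerDecode (medianCode σ)

/-- The permutations obtained by breaking the ties of `σ₀`. -/
def tieBreakings {n : ℕ} (σ₀ : PartialRanking n) : Set (Equiv.Perm (Fin n)) :=
  {τ | ∀ x y, σ₀.1 x < σ₀.1 y → τ x < τ y}

/-! A permutation breaks the ties of `σ₀` as soon as its Lehmer code lies between the strict and the
weak code of `σ₀`. So the aggregator can fail only if, for some `x`, at least half of the votes lie
on one side of the admissible positions. These are `2n` events. By Hoeffding's inequality each has
probability at most `δ / (2n)`, provided that the expected share of one ranking's vote on a given
side is at most `c = (s + s²) / 2 = 1 - q'`, where `s = φ^(1/2)`.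

That expectation is the heart (`sum_mul_displacement_le`). The share before the admissible positions
is at most `displacement`, which ignores the labels of the elements and so allows them to be moved
freely. Two injective surgeries compare the weights of rankings. If `j` elements that should precede
`x` are tied with it, splitting them off just before `x` gains a factor `s^j` (`exists_split`). If
there are no such ties but `x` is overtaking, exchanging `x` with the first bucket of `k` elements
that it overtook gains `s^(2k)` (`exists_exchange`). Both surgeries land in the rankings without
such ties, so it is enough to prove an inequality for each of these, with a multiplier `l` on the
exchange inequality. The other side follows by reversing all buckets. -/

/-! ### The Kemeny distance and comparison of weights -/

/-- The sign of the comparison of two bucket indices. -/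
def cmpSign {n : ℕ} (a b : Fin n) : ℤ := if a < b then -1 else if b < a then 1 else 0

/-- As an integer `ℓ¹` distance of sign matrices, the distance can be compared pair by pair. The
factor 4 arises because an inversion contributes 2 in each of the two orders of its pair. -/
theorem four_mul_kemenyDist {n : ℕ} (π σ : PartialRanking n) :
    4 * kemenyDist π σ =
      ((∑ a, ∑ b, |cmpSign (π.1 a) (π.1 b) - cmpSign (σ.1 a) (σ.1 b)| : ℤ) : ℝ) := by
  let e : Fin n → Fin n → ℝ := fun a b =>
    (if π.1 a > π.1 b ∧ σ.1 a < σ.1 b then 1 else 0) +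
      1 / 2 * (if (π.1 a = π.1 b ∧ σ.1 a > σ.1 b) ∨ (π.1 a > π.1 b ∧ σ.1 a = σ.1 b) then 1 else 0)
  have h1 : kemenyDist π σ = ∑ a, ∑ b, e a b := by
    rw [kemenyDist, Finset.card_filter, Finset.card_filter]
    push_cast
    rw [Fintype.sum_prod_type, Fintype.sum_prod_type, Finset.mul_sum, ← Finset.sum_add_distrib]
    refine Finset.sum_congr rfl fun a _ => ?_
    rw [Finset.mul_sum, ← Finset.sum_add_distrib]
  have h2 : ∀ a b, ((|cmpSign (π.1 a) (π.1 b) - cmpSign (σ.1 a) (σ.1 b)| : ℤ) : ℝ) =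
      2 * e a b + 2 * e b a := by
    intro a b
    simp only [e, cmpSign]
    rcases lt_trichotomy (π.1 a) (π.1 b) with h | h | h <;>
      rcases lt_trichotomy (σ.1 a) (σ.1 b) with h' | h' | h' <;>
      simp [h, h', not_lt_of_gt, ne_of_lt, ne_of_gt]
  push_cast
  have h3 : ∀ a b, |((cmpSign (π.1 a) (π.1 b) : ℤ) : ℝ) - ((cmpSign (σ.1 a) (σ.1 b) : ℤ) : ℝ)| =
      2 * e a b + 2 * e b a := by
    intro a b
    rw [← h2]
    push_cast
    rfl
  simp only [h3, Finset.sum_add_distrib, ← Finset.mul_sum]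
  rw [Finset.sum_comm (f := fun a b => e b a), h1]
  ring

theorem rpow_kemenyDist_le {n : ℕ} {φ : ℝ} (hφ : 0 < φ) (hφ1 : φ ≤ 1) {σ₀ σ σ' : PartialRanking n}
    (j : ℕ)
    (h : ∑ a, ∑ b, |cmpSign (σ₀.1 a) (σ₀.1 b) - cmpSign (σ'.1 a) (σ'.1 b)| + 2 * j ≤
      ∑ a, ∑ b, |cmpSign (σ₀.1 a) (σ₀.1 b) - cmpSign (σ.1 a) (σ.1 b)|) :
    φ ^ kemenyDist σ₀ σ ≤ (φ ^ (1 / 2 : ℝ)) ^ j * φ ^ kemenyDist σ₀ σ' := by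
  have h' : 4 * kemenyDist σ₀ σ' + 2 * j ≤ 4 * kemenyDist σ₀ σ := by
    rw [four_mul_kemenyDist, four_mul_kemenyDist]
    exact_mod_cast h
  rw [← Real.rpow_natCast, ← Real.rpow_mul hφ.le, ← Real.rpow_add hφ]
  exact Real.rpow_le_rpow_of_exponent_ge hφ hφ1 (by linarith)

theorem sum_le_sum_of_leftUnique {α β : Type*} [Nonempty β] {s : Finset α} {t : Finset β} {f : α → ℝ}
    {g : β → ℝ} (R : α → β → Prop) (hR : ∀ a a' b, R a b → R a' b → a = a')
    (hg : ∀ b ∈ t, 0 ≤ g b) (h : ∀ a ∈ s, ∃ b ∈ t, R a b ∧ f a ≤ g b) :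
    ∑ a ∈ s, f a ≤ ∑ b ∈ t, g b := by
  classical
  choose! e he using h
  have hinj : Set.InjOn e s := fun a ha a' ha' haa =>
    hR a a' (e a) (he a ha).2.1 (haa ▸ (he a' ha').2.1)
  calc ∑ a ∈ s, f a ≤ ∑ a ∈ s, g (e a) := Finset.sum_le_sum fun a ha => (he a ha).2.2
    _ = ∑ b ∈ s.image e, g b := (Finset.sum_image hinj).symm
    _ ≤ ∑ b ∈ t, g b := Finset.sum_le_sum_of_subset_of_nonneg
        (fun b hb => by
          obtain ⟨a, ha, rfl⟩ := Finset.mem_image.1 hb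
          exact (he a ha).1) fun b hb _ => hg b hb

/-! ### Two injective surgeries on partial rankings -/

/-- The elements ranked before `x` by `σ₀` and tied with `x` by `σ`. -/
def tiedBefore {n : ℕ} (σ₀ : PartialRanking n) (x : Fin n) (σ : PartialRanking n) :
    Finset (Fin n) :=
  {y | σ₀.1 y < σ₀.1 x ∧ σ.1 y = σ.1 x}

/-- Some element ranked before `x` by `σ₀` is ranked after `x` by `σ`. -/
def Overtakes {n : ℕ} (σ₀ : PartialRanking n) (x : Fin n) (σ : PartialRanking n) : Prop :=
  ∃ y, σ₀.1 y < σ₀.1 x ∧ σ.1 x < σ.1 y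

/-- Among the elements ranked before `x` by both `σ₀` and `σ`, those ranked last by `σ`. -/
def precedingBucket {n : ℕ} (σ₀ : PartialRanking n) (x : Fin n) (σ : PartialRanking n) :
    Finset (Fin n) :=
  {y | σ₀.1 y < σ₀.1 x ∧ σ.1 y < σ.1 x ∧
    ∀ z, σ₀.1 z < σ₀.1 x → σ.1 z < σ.1 x → σ.1 z ≤ σ.1 y}

/-- The bucket of `x` is split, with the elements that `σ₀` ranks before `x` in front. Every newly
separated pair is separated as in `σ₀`, so no pair gets worse. Merging the bucket of `x` with the
one before it recovers `σ`. -/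
theorem exists_split {n : ℕ} {φ : ℝ} (hφ : 0 < φ) (hφ1 : φ ≤ 1) (σ₀ : PartialRanking n) (x : Fin n)
    (σ : PartialRanking n) (hk : (tiedBefore σ₀ x σ).Nonempty) :
    ∃ σ' : PartialRanking n, tiedBefore σ₀ x σ' = ∅ ∧
      (∀ y, (σ.1 y : ℕ) = if σ'.1 x ≤ σ'.1 y then (σ'.1 y : ℕ) - 1 else σ'.1 y) ∧
      (Overtakes σ₀ x σ' ↔ Overtakes σ₀ x σ) ∧
      precedingBucket σ₀ x σ' = tiedBefore σ₀ x σ ∧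
      φ ^ kemenyDist σ₀ σ ≤ (φ ^ (1 / 2 : ℝ)) ^ #(tiedBefore σ₀ x σ) * φ ^ kemenyDist σ₀ σ' := by
  obtain ⟨k, hk⟩ := hk
  simp only [tiedBefore, Finset.mem_filter, Finset.mem_univ, true_and] at hk
  -- There is room for one more bucket: otherwise all `n` indices are in use and no tie is possible.
  have hlt : ∀ y, (σ.1 y : ℕ) + 1 < n := by
    intro y
    by_contra hy
    have hsurj : Function.Surjective σ.1 := fun b => by
      rcases eq_or_ne b (σ.1 y) with rfl | hb
      · exact ⟨y, rfl⟩
      · exact σ.2 y b (Fin.lt_def.2 (by omega))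
    have := (Finite.injective_iff_surjective.2 hsurj) hk.2
    rw [this] at hk
    exact lt_irrefl _ hk.1
  let P : Fin n → Prop := fun y => σ.1 y < σ.1 x ∨ (σ.1 y = σ.1 x ∧ σ₀.1 y < σ₀.1 x)
  classical
  let f : Fin n → Fin n := fun y => if P y then σ.1 y else ⟨σ.1 y + 1, hlt y⟩
  have hf : ∀ y, (f y : ℕ) = if P y then (σ.1 y : ℕ) else σ.1 y + 1 := fun y => by
    simp only [f]; split_ifs <;> rfl
  have hPx : ¬ P x := by simp [P]
  have hfx : (f x : ℕ) = σ.1 x + 1 := by rw [hf, if_neg hPx]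
  have hbucket : IsBucketOrder f := by
    intro y b hb
    rw [Fin.lt_def, hf] at hb
    rcases lt_trichotomy (b : ℕ) (σ.1 x) with h | h | h
    · obtain ⟨z, hz⟩ := σ.2 x b (Fin.lt_def.2 h)
      refine ⟨z, Fin.ext ?_⟩
      rw [hf, if_pos (Or.inl (by rw [hz]; exact Fin.lt_def.2 h)), hz]
    · refine ⟨k, Fin.ext ?_⟩
      rw [hf, if_pos (Or.inr ⟨hk.2, hk.1⟩), hk.2, h]
    · have hby : (b : ℕ) - 1 ≤ σ.1 y := by split_ifs at hb <;> omega
      rcases eq_or_ne (b : ℕ) (σ.1 x + 1) with h' | h'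
      · exact ⟨x, Fin.ext (by rw [hfx, h'])⟩
      · have : ∃ z, (σ.1 z : ℕ) = b - 1 := by
          rcases hby.lt_or_eq with h2 | h2
          · obtain ⟨z, hz⟩ := σ.2 y ⟨(b : ℕ) - 1, by omega⟩ (Fin.lt_def.2 h2)
            exact ⟨z, by rw [hz]⟩
          · exact ⟨y, h2.symm⟩
        obtain ⟨z, hz⟩ := this
        refine ⟨z, Fin.ext ?_⟩
        rw [hf, if_neg]
        · omega
        · simp only [P, Fin.lt_def, Fin.ext_iff]; omega
  have key : ∀ y, (P y ∧ (f y : ℕ) = σ.1 y) ∨ (¬ P y ∧ (f y : ℕ) = σ.1 y + 1) := fun y => by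
    rw [hf]; by_cases h : P y <;> simp [h]
  simp only [P, Fin.lt_def, Fin.ext_iff] at key hk
  refine ⟨⟨f, hbucket⟩, ?_, ?_, ?_, ?_, ?_⟩
  · ext y
    simp only [tiedBefore, Finset.mem_filter, Finset.mem_univ, true_and, Finset.notMem_empty,
      iff_false, Fin.lt_def, Fin.ext_iff]
    have := key y
    omega
  · intro y
    have := key y
    simp only [Fin.le_def]
    split_ifs <;> omega
  · simp only [Overtakes, Fin.lt_def]
    refine exists_congr fun y => ?_
    have := key y
    omega
  · ext y
    simp only [precedingBucket, tiedBefore, Finset.mem_filter, Finset.mem_univ, true_and,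
      Fin.lt_def, Fin.ext_iff, Fin.le_def]
    have := key y
    constructor
    · rintro ⟨h1, h2, h3⟩
      have h4 := h3 k hk.1
      have := key k
      omega
    · rintro ⟨h1, h2⟩
      refine ⟨h1, by omega, fun z hz hz' => ?_⟩
      have := key z
      omega
  · refine rpow_kemenyDist_le hφ hφ1 _ ?_
    have hpt : ∀ a b, |cmpSign (σ₀.1 a) (σ₀.1 b) - cmpSign (f a) (f b)| +
        ((if b = x then if a ∈ tiedBefore σ₀ x σ then 1 else 0 else 0) +
          (if a = x then if b ∈ tiedBefore σ₀ x σ then 1 else 0 else 0)) ≤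
        |cmpSign (σ₀.1 a) (σ₀.1 b) - cmpSign (σ.1 a) (σ.1 b)| := by
      intro a b
      have ha := key a
      have hb := key b
      simp only [tiedBefore, Finset.mem_filter, Finset.mem_univ, true_and, cmpSign, Fin.lt_def,
        Fin.ext_iff]
      by_cases hax : (a : ℕ) = x <;> by_cases hbx : (b : ℕ) = x
      · obtain rfl := Fin.ext hax
        obtain rfl := Fin.ext hbx
        simp
      · obtain rfl := Fin.ext hax
        rw [if_neg hbx, if_pos rfl]
        split_ifs <;> first | omega | simp
      · obtain rfl := Fin.ext hbx
        rw [if_neg hax, if_pos rfl]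
        split_ifs <;> first | omega | simp
      · rw [if_neg hax, if_neg hbx]
        split_ifs <;> first | omega | simp
    have := Finset.sum_le_sum fun a (_ : a ∈ Finset.univ) =>
      Finset.sum_le_sum fun b (_ : b ∈ Finset.univ) => hpt a b
    simp only [Finset.sum_add_distrib] at this
    rw [Finset.sum_comm (f := fun a b => if a = x then _ else _)] at this
    simp only [Finset.sum_ite_eq', Finset.mem_univ, if_true, Finset.sum_boole,
      Finset.filter_univ_mem] at this
    linarith

/-- The first bucket after `x` with elements that should precede `x` is chosen, and these elements
trade places with `x`. Minimality and the absence of ties make them the preceding bucket of `x`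
afterwards, so they can be identified and the exchange undone. -/
theorem exists_exchange {n : ℕ} {φ : ℝ} (hφ : 0 < φ) (hφ1 : φ ≤ 1) (σ₀ : PartialRanking n)
    (x : Fin n) (σ : PartialRanking n) (hk : tiedBefore σ₀ x σ = ∅) (hx : Overtakes σ₀ x σ) :
    ∃ σ' : PartialRanking n, tiedBefore σ₀ x σ' = ∅ ∧ (precedingBucket σ₀ x σ').Nonempty ∧
      (∀ y ∈ precedingBucket σ₀ x σ', σ.1 y = σ'.1 x ∧ σ'.1 y = σ.1 x) ∧
      (∀ y ∉ precedingBucket σ₀ x σ', y ≠ x → σ.1 y = σ'.1 y) ∧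
      φ ^ kemenyDist σ₀ σ ≤
        (φ ^ (1 / 2 : ℝ)) ^ (2 * #(precedingBucket σ₀ x σ')) * φ ^ kemenyDist σ₀ σ' := by
  classical
  have hk' : ∀ y, σ₀.1 y < σ₀.1 x → σ.1 y ≠ σ.1 x := fun y h1 h2 =>
    (Finset.eq_empty_iff_forall_notMem.1 hk y) (by simp [tiedBefore, h1, h2])
  obtain ⟨z, hz, hzmin⟩ : ∃ z, (σ₀.1 z < σ₀.1 x ∧ σ.1 x < σ.1 z) ∧
      ∀ y, σ₀.1 y < σ₀.1 x → σ.1 x < σ.1 y → σ.1 z ≤ σ.1 y := by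
    obtain ⟨z, hz, hz'⟩ := Finset.exists_min_image
      ({y | σ₀.1 y < σ₀.1 x ∧ σ.1 x < σ.1 y} : Finset (Fin n)) σ.1
      (by obtain ⟨y, hy⟩ := hx; exact ⟨y, by simpa using hy⟩)
    simp only [Finset.mem_filter, Finset.mem_univ, true_and, and_imp] at hz hz'
    exact ⟨z, hz, hz'⟩
  let K : Fin n → Prop := fun y => σ₀.1 y < σ₀.1 x ∧ σ.1 y = σ.1 z
  have hxK : ¬ K x := fun h => lt_irrefl _ h.1
  have hzx : z ≠ x := fun h => by rw [h] at hz; exact lt_irrefl _ hz.1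
  have hzK : K z := ⟨hz.1, rfl⟩
  let f : Fin n → Fin n := fun y => if y = x then σ.1 z else if K y then σ.1 x else σ.1 y
  have hfx : f x = σ.1 z := by simp [f]
  have hfK : ∀ y, K y → f y = σ.1 x := fun y hy => by
    simp only [f]
    rw [if_neg (by rintro rfl; exact hxK hy), if_pos hy]
  have hfo : ∀ y, y ≠ x → ¬ K y → f y = σ.1 y := fun y h1 h2 => by
    simp only [f]
    rw [if_neg h1, if_neg h2]
  have hbucket : IsBucketOrder f := by
    have hle : ∀ y, ∃ y', f y ≤ σ.1 y' := fun y => by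
      simp only [f]; split_ifs <;> exact ⟨_, le_rfl⟩
    intro y b hb
    obtain ⟨y', hy'⟩ := hle y
    obtain ⟨w, hw⟩ := σ.2 y' b (hb.trans_le hy')
    by_cases hwx : w = x
    · exact ⟨z, by rw [hfK z hzK, ← hw, hwx]⟩
    · by_cases hwK : K w
      · exact ⟨x, by rw [hfx, ← hw, hwK.2]⟩
      · exact ⟨w, by rw [hfo w hwx hwK, hw]⟩
  have key : ∀ y, (y = x ∧ f y = σ.1 z) ∨ (y ≠ x ∧ K y ∧ f y = σ.1 x) ∨
      (y ≠ x ∧ ¬ K y ∧ f y = σ.1 y) := fun y => by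
    by_cases h1 : y = x
    · exact Or.inl ⟨h1, h1 ▸ hfx⟩
    · by_cases h2 : K y
      · exact Or.inr (Or.inl ⟨h1, h2, hfK y h2⟩)
      · exact Or.inr (Or.inr ⟨h1, h2, hfo y h1 h2⟩)
  have hprec : precedingBucket σ₀ x ⟨f, hbucket⟩ = ({y | K y} : Finset (Fin n)) := by
    ext y
    simp only [precedingBucket, Finset.mem_filter, Finset.mem_univ, true_and, hfx]
    have hy := key y
    have hy1 := hk' y
    have hy2 := hzmin y
    constructor
    · rintro ⟨h1, h2, h3⟩
      have h4 := h3 z hz.1 (by rw [hfK z hzK]; exact hz.2)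
      rw [hfK z hzK] at h4
      rcases hy with ⟨rfl, _⟩ | ⟨_, h, _⟩ | ⟨_, _, h⟩
      · exact absurd h1 (lt_irrefl _)
      · exact h
      · rw [h] at h2 h4
        exact absurd (hy2 h1 (lt_of_le_of_ne h4 (hy1 h1).symm)) (not_le.2 h2)
    · intro h
      rw [hfK y h]
      refine ⟨h.1, hz.2, fun w hw hw' => ?_⟩
      rcases key w with ⟨rfl, _⟩ | ⟨_, _, h⟩ | ⟨_, _, h⟩
      · exact absurd hw (lt_irrefl _)
      · exact h.le
      · rw [h] at hw' ⊢
        by_contra hcon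
        exact absurd (hzmin w hw (not_le.1 hcon)) (not_le.2 hw')
  refine ⟨⟨f, hbucket⟩, ?_, ?_, ?_, ?_, ?_⟩
  · refine Finset.eq_empty_iff_forall_notMem.2 fun y hy => ?_
    simp only [tiedBefore, Finset.mem_filter, Finset.mem_univ, true_and, hfx] at hy
    rcases key y with ⟨rfl, _⟩ | ⟨_, _, h⟩ | ⟨_, h', h⟩
    · exact lt_irrefl _ hy.1
    · rw [h] at hy; exact hz.2.ne hy.2
    · rw [h] at hy; exact h' hy
  · rw [hprec]
    exact ⟨z, by simp [hzK]⟩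
  · intro y hy
    rw [hprec] at hy
    simp only [Finset.mem_filter, Finset.mem_univ, true_and] at hy
    exact ⟨hy.2.trans hfx.symm, hfK y hy⟩
  · intro y hy hyx
    rw [hprec] at hy
    simp only [Finset.mem_filter, Finset.mem_univ, true_and] at hy
    exact (hfo y hyx hy).symm
  · refine rpow_kemenyDist_le hφ hφ1 _ ?_
    rw [hprec]
    let D : Fin n → Fin n → ℤ := fun a b => |cmpSign (σ₀.1 a) (σ₀.1 b) - cmpSign (σ.1 a) (σ.1 b)| -
      |cmpSign (σ₀.1 a) (σ₀.1 b) - cmpSign (f a) (f b)|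
    have hDsymm : ∀ a b, D a b = D b a := fun a b => by
      have hanti : ∀ i j : Fin n, cmpSign i j = -cmpSign j i := fun i j => by
        simp only [cmpSign, Fin.lt_def]; split_ifs <;> omega
      simp only [D]
      rw [hanti (σ₀.1 a), hanti (σ.1 a), hanti (f a), neg_sub_neg, neg_sub_neg, abs_sub_comm,
        abs_sub_comm (cmpSign (f b) (f a))]
    have hDxK : ∀ b, K b → D x b = 2 := fun b hb => by
      have h1 := hfK b hb
      have h2 := hz.2
      have h3 := hb.1
      have h4 := hb.2
      simp only [D, hfx, h1, h4]
      simp [cmpSign, h2, h3, not_lt_of_gt]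
    -- Only elements in the range swept by the exchange matter, and by the choice of `z` none of
    -- those outside `K` should precede `x`.
    have hN : ∀ w, w ≠ x → ¬ K w → σ.1 x ≤ σ.1 w → σ.1 w ≤ σ.1 z → σ₀.1 x ≤ σ₀.1 w := by
      intro w h1 h2 h3 h4
      by_contra hcon
      rw [not_le] at hcon
      have h5 := hzmin w hcon (lt_of_le_of_ne h3 (hk' w hcon).symm)
      exact h2 ⟨hcon, le_antisymm h4 h5⟩
    have hDK : ∀ a w, K a → w ≠ x → ¬ K w → 0 ≤ D a w ∧ 0 ≤ D x w + D a w := by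
      intro a w ha h1 h2
      have h3 := hN w h1 h2
      have h4 := hz.2
      have h5 := ha.1
      simp only [D, cmpSign, hfx, hfK a ha, ha.2, hfo w h1 h2]
      simp only [Fin.lt_def, Fin.le_def] at h3 h4 h5 ⊢
      constructor <;> split_ifs <;> first | omega | simp
    have hDnonneg : ∀ a b, a ≠ x → b ≠ x → 0 ≤ D a b := by
      intro a b hax hbx
      by_cases ha : K a <;> by_cases hb : K b
      · simp [D, hfK a ha, hfK b hb, ha.2, hb.2, cmpSign]
      · exact (hDK a b ha hbx hb).1
      · rw [hDsymm]; exact (hDK b a hb hax ha).1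
      · simp [D, hfo a hax ha, hfo b hbx hb]
    -- A pair `(x, w)` may get worse, but the gain of `(z, w)` makes up for it. In `hpt` the amount
    -- `δ w` is transferred from the latter to the former; the transfers cancel in the double sum.
    let δ : Fin n → ℤ := fun w => if w = x ∨ K w then 0 else D z w
    have hδ : ∀ w, w ≠ x → δ w ≤ D z w := fun w hw => by
      simp only [δ]; split_ifs
      · exact hDnonneg z w hzx hw
      · exact le_rfl
    have hpt : ∀ a b, (if a = z then δ b else 0) - (if a = x then δ b else 0) +
        ((if b = z then δ a else 0) - (if b = x then δ a else 0)) +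
        ((if a = x then if K b then 2 else 0 else 0) +
          (if b = x then if K a then 2 else 0 else 0)) ≤ D a b := by
      have hδx : δ x = 0 := by simp [δ]
      have hδK : ∀ b, K b → δ b = 0 := fun b hb => by simp [δ, hb]
      have hx' : ∀ b, b ≠ x → (if b = z then δ x else 0) - δ b + (if K b then 2 else 0) ≤ D x b := by
        intro b hb
        rw [hδx, ite_self]
        by_cases hbK : K b
        · rw [hδK b hbK, if_pos hbK, hDxK b hbK]; norm_num
        · rw [if_neg hbK]
          have := (hDK z b hzK hb hbK).2
          simp only [δ, hb, hbK, or_self, if_false]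
          omega
      have hz' : ∀ b, b ≠ x → δ b + (if b = z then δ z else 0) ≤ D z b := by
        intro b hb
        rw [hδK z hzK, ite_self, add_zero]
        exact hδ b hb
      intro a b
      by_cases hax : a = x <;> by_cases hbx : b = x
      · subst hax; subst hbx
        simp [D, hxK, hδx, cmpSign]
      · subst hax
        have := hx' b hbx
        simp only [hbx, hzx.symm, if_true, if_false]
        omega
      · subst hbx
        have := hx' a hax
        rw [hDsymm a b]
        simp only [hax, hzx.symm, if_true, if_false]
        omega
      · by_cases haz : a = z
        · subst haz
          have := hz' b hbx
          simp only [hax, hbx, if_true, if_false]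
          omega
        · by_cases hbz : b = z
          · subst hbz
            have := hz' a hax
            rw [hDsymm a b]
            simp only [hax, hbx, haz, if_true, if_false] at this ⊢
            omega
          · have := hDnonneg a b hax hbx
            simp only [hax, hbx, haz, hbz, if_false]
            omega
    have := Finset.sum_le_sum fun a (_ : a ∈ Finset.univ) =>
      Finset.sum_le_sum fun b (_ : b ∈ Finset.univ) => hpt a b
    simp only [Finset.sum_add_distrib, Finset.sum_sub_distrib, D] at this
    rw [Finset.sum_comm (f := fun a b => if a = x then δ b else 0),
      Finset.sum_comm (f := fun a b => if a = z then δ b else 0),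
      Finset.sum_comm (f := fun a b => if a = x then if K b then 2 else 0 else 0)] at this
    have hcard : ∑ b, (if K b then (2 : ℤ) else 0) = #({b | K b} : Finset (Fin n)) * 2 := by
      rw [← Finset.sum_filter, Finset.sum_const, nsmul_eq_mul]
    simp only [Finset.sum_ite_eq', Finset.mem_univ, if_true, hcard] at this
    push_cast
    linarith

/-! ### The expected displacement -/

open Classical in
/-- A bound on the share of the vote of `σ` that places `x` before the element that is ranked
last by `σ` among those ranked before `x` by `σ₀`. -/
noncomputable def displacement {n : ℕ} (σ₀ : PartialRanking n) (x : Fin n)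
    (σ : PartialRanking n) : ℝ :=
  if Overtakes σ₀ x σ then 1 else (#(tiedBefore σ₀ x σ) : ℝ) / (#(tiedBefore σ₀ x σ) + 1)

/-- The left side factors as `l (1 + q) (q - s)`. -/
theorem excess_overtaking {s c l q : ℝ} (hl : l * (1 - s) = 1 - c) (hl0 : 0 ≤ l) (hq0 : 0 ≤ q)
    (hq : q ≤ s) : (1 - c) * q + (1 - c) + l * (q ^ 2 - 1) ≤ 0 := by
  rw [← hl]
  nlinarith [mul_nonneg (mul_nonneg hl0 (add_nonneg zero_le_one hq0)) (sub_nonneg.2 hq)]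

/-- Equality holds at `j = 1`, which is what dictates the value of `c`. For `j ≥ 2` crude bounds
leave room. -/
theorem excess_tied {s c l : ℝ} (hs : 0 < s) (hs1 : s + s ^ 2 < 1) (hc : c = (s + s ^ 2) / 2)
    (hl : l * (1 - s) = 1 - c) (hl0 : 0 ≤ l) {j : ℕ} (hj : 1 ≤ j) :
    max ((j : ℝ) / (j + 1) - c) 0 * s ^ j - c + l * (s ^ j) ^ 2 ≤ 0 := by
  have h1s : 0 < 1 - s := by nlinarith
  rcases hj.eq_or_lt with rfl | hj2
  · have h : 0 ≤ ((1 : ℕ) : ℝ) / ((1 : ℕ) + 1) - c := by rw [hc]; norm_num; linarith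
    rw [max_eq_left h]
    refine le_of_mul_le_mul_right ?_ h1s
    have : l * s ^ 2 * (1 - s) = (1 - c) * s ^ 2 := by rw [← hl]; ring
    norm_num
    rw [hc] at this ⊢
    nlinarith
  · have hc1 : 0 ≤ 1 - c := by rw [hc]; linarith
    have h : max ((j : ℝ) / (j + 1) - c) 0 ≤ 1 - c := by
      refine max_le (sub_le_sub_right ?_ _) hc1
      rw [div_le_one (by positivity)]
      linarith
    have hsj : s ^ j ≤ s ^ 2 := pow_le_pow_of_le_one hs.le (by linarith) hj2
    have hsj0 : 0 ≤ s ^ j := by positivity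
    have h2 : max ((j : ℝ) / (j + 1) - c) 0 * s ^ j ≤ (1 - c) * s ^ 2 :=
      mul_le_mul h hsj hsj0 hc1
    have h3 : l * (s ^ j) ^ 2 ≤ l * (s ^ 2) ^ 2 := by gcongr
    have h4 : l * (s ^ 2) ^ 2 ≤ (1 - c) * s ^ 2 := by
      rw [← hl]
      nlinarith [mul_nonneg (mul_nonneg hl0 (sq_nonneg s)) (sub_nonneg.2 hs1.le)]
    have h5 : 2 * ((1 - c) * s ^ 2) ≤ c := by
      -- On `s > 0` this cubic has its minimum near `s = 0.448`, where it is positive.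
      have : 0 ≤ 2 * s ^ 3 + 2 * s ^ 2 - 3 * s + 1 := by
        nlinarith [mul_nonneg hs.le (sq_nonneg (s - 0.45)), sq_nonneg (s - 0.448)]
      rw [hc]
      nlinarith [mul_nonneg hs.le this]
    linarith

theorem sum_mul_displacement_le {n : ℕ} {φ : ℝ} (hφ : 0 < φ) (hφ1 : φ + φ ^ (1 / 2 : ℝ) < 1)
    (σ₀ : PartialRanking n) (x : Fin n) :
    ∑ σ, φ ^ kemenyDist σ₀ σ * displacement σ₀ x σ ≤
      (1 / 2 * φ ^ (1 / 2 : ℝ) + 1 / 2 * φ) * ∑ σ, φ ^ kemenyDist σ₀ σ := by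
  classical
  have hs : 0 < φ ^ (1 / 2 : ℝ) := by positivity
  have hsφ : φ = (φ ^ (1 / 2 : ℝ)) ^ 2 := by
    rw [← Real.rpow_natCast, ← Real.rpow_mul hφ.le]; norm_num
  have hφle : φ ≤ 1 := by linarith
  have hw : ∀ σ, 0 < φ ^ kemenyDist σ₀ σ := fun σ => by positivity
  have split := exists_split hφ hφle σ₀ x
  have exch := exists_exchange hφ hφle σ₀ x
  set s := φ ^ (1 / 2 : ℝ)
  set w : PartialRanking n → ℝ := fun σ => φ ^ kemenyDist σ₀ σ
  obtain ⟨c, hc⟩ : ∃ c, c = (s + s ^ 2) / 2 := ⟨_, rfl⟩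
  have hc' : 1 / 2 * s + 1 / 2 * φ = c := by rw [hc, ← hsφ]; ring
  have hs1 : s + s ^ 2 < 1 := by rw [← hsφ]; linarith
  have h1s : 0 < 1 - s := by nlinarith
  have hc0 : 0 ≤ c := by rw [hc]; positivity
  have hc1 : 0 ≤ 1 - c := by rw [hc]; linarith
  -- The multiplier of `h2`: the least one for which the overtaking case holds at `q = s`.
  obtain ⟨l, hl⟩ : ∃ l, l * (1 - s) = 1 - c := ⟨(1 - c) / (1 - s), div_mul_cancel₀ _ h1s.ne'⟩
  have hl0 : 0 ≤ l := nonneg_of_mul_nonneg_left (hl ▸ hc1) h1s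
  let O : PartialRanking n → Prop := Overtakes σ₀ x
  let T : PartialRanking n → Finset (Fin n) := tiedBefore σ₀ x
  let J : PartialRanking n → Finset (Fin n) := precedingBucket σ₀ x
  -- The excess over `c` of the ranking split into `σ`, truncated at 0 so that its weight may be
  -- replaced by an upper bound.
  let r : PartialRanking n → ℕ → ℝ := fun σ k =>
    if O σ then 1 - c else max ((k : ℝ) / (k + 1) - c) 0
  have hr0 : ∀ σ k, 0 ≤ r σ k := fun σ k => by
    simp only [r]; split_ifs
    · exact hc1
    · exact le_max_right _ _
  -- If `J σ` is empty, `σ` results from neither surgery. Otherwise a split into `σ` costs at most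
  -- `q σ` and an exchange at most `q σ ^ 2`.
  let q : PartialRanking n → ℝ := fun σ => if (J σ).Nonempty then s ^ #(J σ) else 0
  have hq0 : ∀ σ, 0 ≤ q σ := fun σ => by simp only [q]; split_ifs <;> positivity
  have hqs : ∀ σ, q σ ≤ s := fun σ => by
    simp only [q]; split_ifs with h
    · exact pow_le_of_le_one hs.le (by linarith) (Finset.card_pos.2 h).ne'
    · exact hs.le
  let X₀ : Finset (PartialRanking n) := {σ | T σ = ∅}
  let X₁ : Finset (PartialRanking n) := {σ | ¬ T σ = ∅}
  have hne : Nonempty (PartialRanking n) := ⟨σ₀⟩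
  have h1 : ∑ σ ∈ X₁, w σ * (displacement σ₀ x σ - c) ≤ ∑ σ ∈ X₀, r σ #(J σ) * q σ * w σ := by
    refine sum_le_sum_of_leftUnique
      (fun σ σ' => ∀ y, (σ.1 y : ℕ) = if σ'.1 x ≤ σ'.1 y then (σ'.1 y : ℕ) - 1 else σ'.1 y)
      (fun σ σ' τ h h' => Subtype.ext (funext fun y => Fin.ext ((h y).trans (h' y).symm)))
      (fun σ _ => mul_nonneg (mul_nonneg (hr0 _ _) (hq0 _)) (hw σ).le) fun σ hσ => ?_
    have hT : (T σ).Nonempty := Finset.nonempty_iff_ne_empty.2 (Finset.mem_filter.1 hσ).2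
    obtain ⟨σ', hT', hrel, hO, hJ, hle⟩ := split σ hT
    refine ⟨σ', Finset.mem_filter.2 ⟨Finset.mem_univ _, hT'⟩, hrel, ?_⟩
    have hJ' : J σ' = T σ := hJ
    have hd : displacement σ₀ x σ - c ≤ r σ' #(J σ') := by
      simp only [displacement, r, O, hO, hJ']
      split_ifs
      · exact le_rfl
      · exact le_max_left _ _
    have hq : q σ' = s ^ #(T σ) := by simp only [q, hJ', if_pos hT]
    calc w σ * (displacement σ₀ x σ - c) ≤ w σ * r σ' #(J σ') :=
          mul_le_mul_of_nonneg_left hd (hw σ).le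
      _ ≤ (s ^ #(T σ) * w σ') * r σ' #(J σ') := mul_le_mul_of_nonneg_right hle (hr0 _ _)
      _ = r σ' #(J σ') * q σ' * w σ' := by rw [hq]; ring
  have h2 : ∑ σ ∈ X₀ with O σ, w σ ≤ ∑ σ ∈ X₀, q σ ^ 2 * w σ := by
    refine sum_le_sum_of_leftUnique
      (fun σ σ' => (J σ').Nonempty ∧ (∀ y ∈ J σ', σ.1 y = σ'.1 x ∧ σ'.1 y = σ.1 x) ∧
        (∀ y ∉ J σ', y ≠ x → σ.1 y = σ'.1 y)) ?_
      (fun σ _ => mul_nonneg (sq_nonneg _) (hw σ).le) fun σ hσ => ?_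
    · rintro σ σ' τ ⟨⟨z, hz⟩, h1, h2⟩ ⟨_, h1', h2'⟩
      refine Subtype.ext (funext fun y => ?_)
      by_cases hy : y ∈ J τ
      · rw [(h1 y hy).1, (h1' y hy).1]
      · by_cases hyx : y = x
        · rw [hyx, ← (h1 z hz).2, ← (h1' z hz).2]
        · rw [h2 y hy hyx, h2' y hy hyx]
    · simp only [X₀, Finset.mem_filter, Finset.mem_univ, true_and] at hσ
      obtain ⟨σ', hT', hJ, hr1, hr2, hle⟩ := exch σ hσ.1 hσ.2
      refine ⟨σ', Finset.mem_filter.2 ⟨Finset.mem_univ _, hT'⟩, ⟨hJ, hr1, hr2⟩, ?_⟩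
      have hq : q σ' = s ^ #(J σ') := by simp only [q]; rw [if_pos hJ]
      rw [hq, ← pow_mul, mul_comm _ 2]
      exact hle
  have h3 : ∀ σ ∈ X₀, r σ #(J σ) * q σ * w σ + w σ * (displacement σ₀ x σ - c) +
      l * (q σ ^ 2 * w σ - if O σ then w σ else 0) ≤ 0 := by
    intro σ hσ
    have hT : tiedBefore σ₀ x σ = ∅ := (Finset.mem_filter.1 hσ).2
    by_cases hO : O σ
    · have hO' : Overtakes σ₀ x σ := hO
      have := excess_overtaking hl hl0 (hq0 σ) (hqs σ)
      simp only [displacement, if_pos hO', r, if_pos hO]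
      nlinarith [mul_nonpos_of_nonneg_of_nonpos (hw σ).le this]
    · have hO' : ¬ Overtakes σ₀ x σ := hO
      simp only [displacement, if_neg hO', r, if_neg hO, hT, Finset.card_empty, Nat.cast_zero,
        zero_div, zero_sub, sub_zero]
      by_cases hJ : (J σ).Nonempty
      · have := excess_tied hs hs1 hc hl hl0 (Finset.card_pos.2 hJ)
        simp only [q, if_pos hJ]
        nlinarith [mul_nonpos_of_nonneg_of_nonpos (hw σ).le this]
      · simp only [q, if_neg hJ]
        nlinarith [mul_nonneg (hw σ).le hc0]
  have h4 : ∑ σ ∈ X₀, r σ #(J σ) * q σ * w σ + ∑ σ ∈ X₀, w σ * (displacement σ₀ x σ - c) +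
      l * (∑ σ ∈ X₀, q σ ^ 2 * w σ - ∑ σ ∈ X₀ with O σ, w σ) ≤ 0 := by
    rw [Finset.sum_filter O, ← Finset.sum_sub_distrib, Finset.mul_sum, ← Finset.sum_add_distrib,
      ← Finset.sum_add_distrib]
    exact Finset.sum_nonpos h3
  have h5 : ∑ σ, w σ * (displacement σ₀ x σ - c) =
      ∑ σ ∈ X₀, w σ * (displacement σ₀ x σ - c) + ∑ σ ∈ X₁, w σ * (displacement σ₀ x σ - c) :=
    (Finset.sum_filter_add_sum_filter_not _ _ _).symm
  have h6 : ∑ σ, w σ * (displacement σ₀ x σ - c) =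
      ∑ σ, w σ * displacement σ₀ x σ - c * ∑ σ, w σ := by
    rw [Finset.mul_sum, ← Finset.sum_sub_distrib]
    exact Finset.sum_congr rfl fun σ _ => by ring
  rw [hc']
  have h7 := mul_nonneg hl0 (sub_nonneg.2 h2)
  change ∑ σ, w σ * displacement σ₀ x σ ≤ c * ∑ σ, w σ
  linarith

/-! ### Reversal of the buckets -/

theorem exists_reverse {n : ℕ} (f : Fin n → Fin n) (hf : IsBucketOrder f) :
    ∃ g : Fin n → Fin n, IsBucketOrder g ∧
      ∀ y, (g y : ℕ) = (Finset.univ.sup fun z => (f z : ℕ)) - f y := by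
  set M := Finset.univ.sup fun z => (f z : ℕ)
  have hM : ∀ y, (f y : ℕ) ≤ M := fun y => Finset.le_sup (f := fun z => (f z : ℕ)) (Finset.mem_univ y)
  have hMn : ∀ y : Fin n, M < n := fun y =>
    (Finset.sup_lt_iff (lt_of_le_of_lt bot_le y.2)).2 fun z _ => (f z).2
  refine ⟨fun y => ⟨M - f y, (Nat.sub_le _ _).trans_lt (hMn y)⟩, ?_, fun y => rfl⟩
  intro y b hb
  rw [Fin.lt_def] at hb
  simp only at hb
  obtain ⟨z, -, hz⟩ := Finset.exists_mem_eq_sup Finset.univ ⟨y, Finset.mem_univ y⟩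
    fun z => (f z : ℕ)
  have hz' : (f z : ℕ) = M := hz.symm
  have : ∃ u, (f u : ℕ) = M - b := by
    rcases Nat.eq_zero_or_pos b with h0 | h0
    · exact ⟨z, by omega⟩
    · obtain ⟨u, hu⟩ := hf z ⟨M - b, by have := hMn y; omega⟩ (Fin.lt_def.2 (by simp only; omega))
      exact ⟨u, by rw [hu]⟩
  obtain ⟨u, hu⟩ := this
  refine ⟨u, Fin.ext ?_⟩
  simp only
  omega

/-- The partial ranking with the buckets in reverse order. -/
noncomputable def reverse {n : ℕ} (σ : PartialRanking n) : PartialRanking n :=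
  ⟨(exists_reverse σ.1 σ.2).choose, (exists_reverse σ.1 σ.2).choose_spec.1⟩

theorem reverse_lt_reverse {n : ℕ} (σ : PartialRanking n) (x y : Fin n) :
    (reverse σ).1 x < (reverse σ).1 y ↔ σ.1 y < σ.1 x := by
  have h := (exists_reverse σ.1 σ.2).choose_spec.2
  have hM : ∀ y, (σ.1 y : ℕ) ≤ Finset.univ.sup fun z => (σ.1 z : ℕ) := fun y =>
    Finset.le_sup (f := fun z => (σ.1 z : ℕ)) (Finset.mem_univ y)
  have hx := hM x
  have hy := hM y
  rw [Fin.lt_def, Fin.lt_def]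
  simp only [reverse, h]
  omega

theorem reverse_eq_reverse {n : ℕ} (σ : PartialRanking n) (x y : Fin n) :
    (reverse σ).1 x = (reverse σ).1 y ↔ σ.1 x = σ.1 y := by
  have h1 := reverse_lt_reverse σ x y
  have h2 := reverse_lt_reverse σ y x
  constructor <;> intro h <;> rcases lt_trichotomy (σ.1 x) (σ.1 y) with h' | h' | h'
  · exact absurd (h2.2 h') (h ▸ lt_irrefl _)
  · exact h'
  · exact absurd (h1.2 h') (h ▸ lt_irrefl _)
  all_goals
    refine le_antisymm (not_lt.1 fun h3 => ?_) (not_lt.1 fun h3 => ?_)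
    · have := h2.1 h3; omega
    · have := h1.1 h3; omega

/-- A partial ranking is determined by the strict order that it induces. -/
theorem PartialRanking.ext_lt {n : ℕ} {σ τ : PartialRanking n}
    (h : ∀ x y, σ.1 x < σ.1 y ↔ τ.1 x < τ.1 y) : σ = τ := by
  have key : ∀ (σ τ : PartialRanking n), (∀ x y, σ.1 x < σ.1 y ↔ τ.1 x < τ.1 y) →
      ∀ t : ℕ, ∀ x, (σ.1 x : ℕ) = t → σ.1 x ≤ τ.1 x := by
    intro σ τ h t
    induction t using Nat.strong_induction_on with
    | _ t ih =>
      intro x hx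
      rcases Nat.eq_zero_or_pos t with h0 | h0
      · rw [Fin.le_def]; omega
      · obtain ⟨y, hy⟩ := σ.2 x ⟨t - 1, by have := (σ.1 x).2; omega⟩
          (Fin.lt_def.2 (by simp only; omega))
        have hyt : (σ.1 y : ℕ) = t - 1 := by rw [hy]
        have h1 := ih (t - 1) (by omega) y hyt
        have h2 := (h y x).1 (Fin.lt_def.2 (by omega))
        rw [Fin.le_def] at h1 ⊢
        rw [Fin.lt_def] at h2
        omega
  exact Subtype.ext (funext fun x =>
    le_antisymm (key σ τ h _ x rfl) (key τ σ (fun a b => (h a b).symm) _ x rfl))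

theorem reverse_reverse {n : ℕ} (σ : PartialRanking n) : reverse (reverse σ) = σ :=
  PartialRanking.ext_lt fun x y => by rw [reverse_lt_reverse, reverse_lt_reverse]

theorem kemenyDist_reverse {n : ℕ} (π σ : PartialRanking n) :
    kemenyDist (reverse π) (reverse σ) = kemenyDist π σ := by
  refine mul_left_cancel₀ (four_ne_zero (α := ℝ)) ?_
  rw [four_mul_kemenyDist, four_mul_kemenyDist, Finset.sum_comm]
  simp only [cmpSign, reverse_lt_reverse]

/-- The equivalence of reversing the order of the buckets. -/
noncomputable def reverseEquiv (n : ℕ) : PartialRanking n ≃ PartialRanking n :=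
  Function.Involutive.toPerm reverse reverse_reverse

theorem sum_mul_displacement_reverse_le {n : ℕ} {φ : ℝ} (hφ : 0 < φ)
    (hφ1 : φ + φ ^ (1 / 2 : ℝ) < 1) (σ₀ : PartialRanking n) (x : Fin n) :
    ∑ σ, φ ^ kemenyDist σ₀ σ * displacement (reverse σ₀) x (reverse σ) ≤
      (1 / 2 * φ ^ (1 / 2 : ℝ) + 1 / 2 * φ) * ∑ σ, φ ^ kemenyDist σ₀ σ := by
  have h := sum_mul_displacement_le hφ hφ1 (reverse σ₀) x
  rw [← (reverseEquiv n).sum_comp, ← (reverseEquiv n).sum_comp fun σ =>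
    φ ^ kemenyDist (reverse σ₀) σ] at h
  have e : ∀ σ, reverseEquiv n σ = reverse σ := fun _ => rfl
  simpa only [e, kemenyDist_reverse] using h

/-! ### From code bounds to tie-breaking -/

/-- Elements are inserted in label order. If the newest one is the first to violate `σ₀`, the order
of the earlier ones forces its code past one of the bounds: above the weak code if it is placed too
early, below the strict code if too late. -/
theorem mem_tieBreakings_of_strictCode {n : ℕ} {σ₀ : PartialRanking n} {τ : Equiv.Perm (Fin n)}
    (h₁ : ∀ x, strictCode σ₀.1 x ≤ strictCode τ x) (h₂ : ∀ x, strictCode τ x ≤ weakCode σ₀.1 x) :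
    τ ∈ tieBreakings σ₀ := by
  have key : ∀ t : ℕ, ∀ x y : Fin n, (x : ℕ) < t → (y : ℕ) < t → σ₀.1 x < σ₀.1 y → τ x < τ y := by
    intro t
    induction t with
    | zero => intro x y hx; omega
    | succ t ih =>
      intro x y hx hy hxy
      have hne : x ≠ y := fun e => by rw [e] at hxy; exact lt_irrefl _ hxy
      have hτ : τ x ≠ τ y := τ.injective.ne hne
      by_contra hcon
      have hlt : τ y < τ x := lt_of_le_of_ne (not_lt.1 hcon) hτ.symm
      rcases lt_or_gt_of_ne hne with hlt' | hlt'
      · refine absurd (h₂ y) (not_le.2 (Finset.card_lt_card ?_))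
        refine Finset.ssubset_iff_of_subset (fun z hz => ?_) |>.2 ⟨x, ?_, ?_⟩
        · simp only [Finset.mem_filter, Finset.mem_univ, true_and] at hz ⊢
          have := Fin.lt_def.1 hz.1
          have := Fin.lt_def.1 hlt'
          exact ⟨hz.1, hlt.trans (ih x z (by omega) (by omega) (hxy.trans_le hz.2))⟩
        · simp [hlt', hlt]
        · simp [hxy]
      · refine absurd (h₁ x) (not_le.2 (Finset.card_lt_card ?_))
        refine Finset.ssubset_iff_of_subset (fun z hz => ?_) |>.2 ⟨y, ?_, ?_⟩
        · simp only [Finset.mem_filter, Finset.mem_univ, true_and] at hz ⊢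
          have h3 := Fin.lt_def.1 hz.1
          have h4 := Fin.lt_def.1 hlt'
          refine ⟨hz.1, hxy.trans_le (not_lt.1 fun h => ?_)⟩
          exact lt_asymm (hlt.trans hz.2) (ih z y (by omega) (by omega) h)
        · simp [hlt', hxy]
        · simp [hlt.le]
  intro x y hxy
  exact key n x y x.2 y.2 hxy

theorem strictCode_lehmerDecode {n : ℕ} (c : (x : Fin n) → Fin ((x : ℕ) + 1)) (x : Fin n) :
    strictCode (lehmerDecode c) x = c x := by
  have : lehmerCode (lehmerDecode c) = c :=
    (Equiv.ofBijective lehmerCode (lehmerCode_bijective n)).apply_symm_apply c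
  exact congrArg Fin.val (congrFun this x)

/-! ### Votes outside the admissible positions -/

theorem weakCode_add_card {n : ℕ} (f : Fin n → Fin n) (x : Fin n) :
    weakCode f x + #{y : Fin n | y < x ∧ f y < f x} = x := by
  have h : #({y : Fin n | y < x} : Finset (Fin n)) = x := by
    have : ({y : Fin n | y < x} : Finset (Fin n)) = Finset.Iio x := by ext; simp
    rw [this, Fin.card_Iio]
  rw [← Finset.card_filter_add_card_filter_not (s := {y : Fin n | y < x})
    (fun y => f y ≥ f x)] at h
  simpa only [weakCode, Finset.filter_filter, not_le, ge_iff_le] using h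

theorem strictCode_add_card {n : ℕ} (f : Fin n → Fin n) (x : Fin n) :
    strictCode f x + #{y : Fin n | y < x ∧ f y ≤ f x} = x := by
  have h : #({y : Fin n | y < x} : Finset (Fin n)) = x := by
    have : ({y : Fin n | y < x} : Finset (Fin n)) = Finset.Iio x := by ext; simp
    rw [this, Fin.card_Iio]
  rw [← Finset.card_filter_add_card_filter_not (s := {y : Fin n | y < x})
    (fun y => f y > f x)] at h
  simpa only [strictCode, Finset.filter_filter, not_lt, gt_iff_lt] using h

theorem weakCode_eq_strictCode_add {n : ℕ} (f : Fin n → Fin n) (x : Fin n) :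
    weakCode f x = strictCode f x + #{y : Fin n | y < x ∧ f y = f x} := by
  rw [weakCode, ← Finset.card_filter_add_card_filter_not (fun y => f y > f x), strictCode,
    Finset.filter_filter, Finset.filter_filter]
  congr 2
  · ext y; simp only [Finset.mem_filter, Finset.mem_univ, true_and]; omega
  · ext y; simp only [Finset.mem_filter, Finset.mem_univ, true_and]; omega

theorem sum_vote {n : ℕ} (σ : PartialRanking n) (x : Fin n) (s : Finset ℕ) :
    ∑ y ∈ s, vote σ x y =
      (#(s ∩ Finset.Icc ((x : ℕ) - weakCode σ.1 x) ((x : ℕ) - strictCode σ.1 x)) : ℝ) /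
        (#{y : Fin n | y < x ∧ σ.1 y = σ.1 x} + 1) := by
  have e : ((weakCode σ.1 x : ℝ) - (strictCode σ.1 x : ℝ) + 1) =
      (#{y : Fin n | y < x ∧ σ.1 y = σ.1 x} : ℝ) + 1 := by
    rw [weakCode_eq_strictCode_add]; push_cast; ring
  simp only [vote, e]
  rw [← Finset.sum_filter, Finset.sum_const, Finset.filter_mem_eq_inter, nsmul_eq_mul]
  ring

theorem card_Icc_code {n : ℕ} (σ : PartialRanking n) (x : Fin n) :
    #(Finset.Icc ((x : ℕ) - weakCode σ.1 x) ((x : ℕ) - strictCode σ.1 x)) =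
      #{y : Fin n | y < x ∧ σ.1 y = σ.1 x} + 1 := by
  have h1 := weakCode_eq_strictCode_add σ.1 x
  have h2 := weakCode_add_card σ.1 x
  rw [Nat.card_Icc]
  omega

theorem sum_vote_le_one {n : ℕ} (σ : PartialRanking n) (x : Fin n) (s : Finset ℕ) :
    ∑ y ∈ s, vote σ x y ≤ 1 := by
  rw [sum_vote, div_le_one (by positivity)]
  have := Finset.card_le_card (Finset.inter_subset_right (s₁ := s)
    (s₂ := Finset.Icc ((x : ℕ) - weakCode σ.1 x) ((x : ℕ) - strictCode σ.1 x)))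
  rw [card_Icc_code] at this
  exact_mod_cast this

theorem sum_vote_range {n : ℕ} (σ : PartialRanking n) (x : Fin n) :
    ∑ y ∈ Finset.range (x + 1), vote σ x y = 1 := by
  rw [sum_vote, Finset.inter_eq_right.2, card_Icc_code]
  · push_cast; exact div_self (by positivity)
  · intro y hy
    rw [Finset.mem_Icc] at hy
    rw [Finset.mem_range]
    omega

theorem vote_nonneg {n : ℕ} (σ : PartialRanking n) (x : Fin n) (y : ℕ) : 0 ≤ vote σ x y := by
  have := sum_vote σ x {y}
  rw [Finset.sum_singleton] at this
  rw [this]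
  positivity

/-- The share of `d` out of `k + 1` positions is at most `j / (j + 1)` if `d ≤ i ≤ min j k`. -/
theorem div_le_div_of_le_min {d i j k : ℕ} (hd : d ≤ i) (hik : i ≤ k) (hij : i ≤ j) :
    (d : ℝ) / (k + 1) ≤ (j : ℝ) / (j + 1) := by
  have h1 : (d : ℝ) ≤ i := by exact_mod_cast hd
  have h2 : (i : ℝ) ≤ k := by exact_mod_cast hik
  have h3 : (i : ℝ) ≤ j := by exact_mod_cast hij
  rw [div_le_div_iff₀ (by positivity) (by positivity)]
  nlinarith [mul_le_mul h1 le_rfl (Nat.cast_nonneg j) (Nat.cast_nonneg i),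
    mul_le_mul_of_nonneg_right h2 (Nat.cast_nonneg j : (0 : ℝ) ≤ j)]

/-- Without overtaking, each `y < x` that should precede `x` does so or is tied with it. Hence the
vote starts early by at most the number `i` of such ties. This `i` is bounded both by all ties with
smaller labels and by `tiedBefore`, whatever the labels there. -/
theorem sum_vote_before_le {n : ℕ} (σ₀ σ : PartialRanking n) (x : Fin n) :
    ∑ y ∈ Finset.range (x - weakCode σ₀.1 x), vote σ x y ≤ displacement σ₀ x σ := by
  rw [displacement]
  split_ifs with hO
  · exact sum_vote_le_one _ _ _
  rw [Overtakes] at hO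
  push Not at hO
  rw [sum_vote]
  have h1 := weakCode_add_card σ₀.1 x
  have h2 := weakCode_add_card σ.1 x
  have h3 : #{y : Fin n | y < x ∧ σ₀.1 y < σ₀.1 x} ≤ #{y : Fin n | y < x ∧ σ.1 y < σ.1 x} +
      #{y : Fin n | y < x ∧ σ₀.1 y < σ₀.1 x ∧ σ.1 y = σ.1 x} := by
    refine le_trans (Finset.card_le_card fun y hy => ?_) (Finset.card_union_le _ _)
    simp only [Finset.mem_union, Finset.mem_filter, Finset.mem_univ, true_and] at hy ⊢
    rcases (hO y hy.2).lt_or_eq with h | h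
    · exact Or.inl ⟨hy.1, h⟩
    · exact Or.inr ⟨hy.1, hy.2, h⟩
  refine div_le_div_of_le_min
    (i := #{y : Fin n | y < x ∧ σ₀.1 y < σ₀.1 x ∧ σ.1 y = σ.1 x}) ?_ ?_ ?_
  · calc _ ≤ #(Finset.Ico ((x : ℕ) - weakCode σ.1 x) (x - weakCode σ₀.1 x)) :=
          Finset.card_le_card fun y hy => by
            simp only [Finset.mem_inter, Finset.mem_range, Finset.mem_Icc, Finset.mem_Ico] at hy ⊢
            omega
      _ ≤ _ := by rw [Nat.card_Ico]; omega
  · exact Finset.card_le_card fun y hy => by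
      simp only [Finset.mem_filter, Finset.mem_univ, true_and] at hy ⊢
      exact ⟨hy.1, hy.2.2⟩
  · exact Finset.card_le_card fun y hy => by
      simp only [tiedBefore, Finset.mem_filter, Finset.mem_univ, true_and] at hy ⊢
      exact hy.2

theorem one_sub_sum_vote_le {n : ℕ} (σ₀ σ : PartialRanking n) (x : Fin n) :
    1 - ∑ y ∈ Finset.range (x - strictCode σ₀.1 x + 1), vote σ x y ≤
      displacement (reverse σ₀) x (reverse σ) := by
  have hsplit : 1 - ∑ y ∈ Finset.range (x - strictCode σ₀.1 x + 1), vote σ x y =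
      ∑ y ∈ Finset.Ico (x - strictCode σ₀.1 x + 1 : ℕ) (x + 1), vote σ x y := by
    rw [← sum_vote_range σ x, ← Finset.sum_range_add_sum_Ico _
      (show (x : ℕ) - strictCode σ₀.1 x + 1 ≤ x + 1 by omega)]
    ring
  rw [hsplit, displacement]
  split_ifs with hO
  · exact sum_vote_le_one _ _ _
  simp only [Overtakes, reverse_lt_reverse] at hO
  push Not at hO
  rw [sum_vote]
  have h1 := strictCode_add_card σ₀.1 x
  have h2 := strictCode_add_card σ.1 x
  have h3 : #{y : Fin n | y < x ∧ σ.1 y ≤ σ.1 x} ≤ #{y : Fin n | y < x ∧ σ₀.1 y ≤ σ₀.1 x} +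
      #{y : Fin n | y < x ∧ σ₀.1 x < σ₀.1 y ∧ σ.1 y = σ.1 x} := by
    refine le_trans (Finset.card_le_card fun y hy => ?_) (Finset.card_union_le _ _)
    simp only [Finset.mem_union, Finset.mem_filter, Finset.mem_univ, true_and] at hy ⊢
    rcases le_or_gt (σ₀.1 y) (σ₀.1 x) with h | h
    · exact Or.inl ⟨hy.1, h⟩
    · exact Or.inr ⟨hy.1, h, le_antisymm hy.2 (hO y h)⟩
  refine div_le_div_of_le_min
    (i := #{y : Fin n | y < x ∧ σ₀.1 x < σ₀.1 y ∧ σ.1 y = σ.1 x}) ?_ ?_ ?_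
  · calc _ ≤ #(Finset.Ioc ((x : ℕ) - strictCode σ₀.1 x) (x - strictCode σ.1 x)) :=
          Finset.card_le_card fun y hy => by
            simp only [Finset.mem_inter, Finset.mem_Icc, Finset.mem_Ico, Finset.mem_Ioc] at hy ⊢
            omega
      _ ≤ _ := by rw [Nat.card_Ioc]; omega
  · exact Finset.card_le_card fun y hy => by
      simp only [Finset.mem_filter, Finset.mem_univ, true_and] at hy ⊢
      exact ⟨hy.1, hy.2.2⟩
  · exact Finset.card_le_card fun y hy => by
      simp only [tiedBefore, Finset.mem_filter, Finset.mem_univ, true_and, reverse_lt_reverse,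
        reverse_eq_reverse] at hy ⊢
      exact hy.2

/-- With less than half of the votes on either side, the median is admissible. The second bound also
shows that the infimum is over a nonempty set. -/
theorem lcaMedian_mem_tieBreakings {n m : ℕ} (hm : 0 < m) (σ₀ : PartialRanking n)
    (σ : Fin m → PartialRanking n)
    (h₁ : ∀ x : Fin n, ∑ k, ∑ y ∈ Finset.range (x - weakCode σ₀.1 x), vote (σ k) x y < m / 2)
    (h₂ : ∀ x : Fin n,
      ∑ k, (1 - ∑ y ∈ Finset.range (x - strictCode σ₀.1 x + 1), vote (σ k) x y) < m / 2) :
    lcaMedian σ ∈ tieBreakings σ₀ := by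
  have hm' : (0 : ℝ) < m := by exact_mod_cast hm
  have hcum : ∀ (x : Fin n) (j : ℕ), ∑ y ∈ Finset.range j, totalVote σ x y =
      ∑ k, ∑ y ∈ Finset.range j, vote (σ k) x y := fun x j => Finset.sum_comm
  have hmem : ∀ x : Fin n, (x : ℕ) - strictCode σ₀.1 x ∈
      {j : ℕ | 1 / 2 ≤ (∑ y ∈ Finset.range (j + 1), totalVote σ x y) / (m : ℝ)} := fun x => by
    have := h₂ x
    rw [Finset.sum_sub_distrib] at this
    simp only [Finset.sum_const, Finset.card_univ, Fintype.card_fin, nsmul_eq_mul, mul_one] at this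
    rw [Set.mem_ofPred_eq, hcum, le_div_iff₀ hm']
    linarith
  have hle : ∀ x : Fin n, medianPosition σ x ≤ (x : ℕ) - strictCode σ₀.1 x := fun x =>
    Nat.sInf_le (hmem x)
  have hge : ∀ x : Fin n, (x : ℕ) - weakCode σ₀.1 x ≤ medianPosition σ x := fun x => by
    refine le_csInf ⟨_, hmem x⟩ fun j hj => ?_
    by_contra hlt
    rw [not_le] at hlt
    rw [Set.mem_ofPred_eq, hcum, le_div_iff₀ hm'] at hj
    have h3 : ∑ k, ∑ y ∈ Finset.range (j + 1), vote (σ k) x y ≤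
        ∑ k, ∑ y ∈ Finset.range (x - weakCode σ₀.1 x), vote (σ k) x y :=
      Finset.sum_le_sum fun k _ => Finset.sum_le_sum_of_subset_of_nonneg
        (Finset.range_subset_range.2 hlt) fun y _ _ => vote_nonneg _ _ _
    linarith [h₁ x]
  have hcode : ∀ x, strictCode (lcaMedian σ) x = x - medianPosition σ x := fun x =>
    strictCode_lehmerDecode (medianCode σ) x
  refine mem_tieBreakings_of_strictCode (fun x => ?_) fun x => ?_
  · have h3 := hle x
    have h4 := strictCode_lt σ₀.1 x
    rw [hcode]
    omega
  · have h3 := hge x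
    rw [hcode]
    omega

/-! ### Concentration and the union bound -/

theorem integral_gmm {n : ℕ} {φ : ℝ} (hφ : 0 < φ) (σ₀ : PartialRanking n)
    (f : PartialRanking n → ℝ) :
    ∫ σ, f σ ∂gmm σ₀ φ =
      (∑ σ, φ ^ kemenyDist σ₀ σ * f σ) / ∑ σ, φ ^ kemenyDist σ₀ σ := by
  rw [gmm, integral_finsetSum_measure fun σ _ =>
    Integrable.of_finite.smul_measure ENNReal.ofReal_ne_top, Finset.sum_div]
  refine Finset.sum_congr rfl fun σ _ => ?_
  rw [integral_smul_measure, integral_dirac, ENNReal.toReal_ofReal, gmmProb, smul_eq_mul]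
  · ring
  · rw [gmmProb]
    positivity

/-- Hoeffding's inequality for variables in `[0, 1]` with mean at most `c`, at deviation `m (1/2 -
c)`. -/
theorem measure_half_le_sum_le {Ω : Type*} [MeasurableSpace Ω] {P : Measure Ω}
    [IsProbabilityMeasure P] {n m : ℕ} {σ₀ : PartialRanking n} {φ c : ℝ} (hφ : 0 < φ)
    {σ : Fin m → Ω → PartialRanking n} (hlaw : ∀ k, HasLaw (σ k) (gmm σ₀ φ) P)
    (hindep : iIndepFun σ P) (hc : c ≤ 1 / 2) {U : PartialRanking n → ℝ}
    (hU0 : ∀ σ, 0 ≤ U σ) (hU1 : ∀ σ, U σ ≤ 1)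
    (hU : ∑ σ, φ ^ kemenyDist σ₀ σ * U σ ≤ c * ∑ σ, φ ^ kemenyDist σ₀ σ) :
    P.real {ω | (m : ℝ) / 2 ≤ ∑ k, U (σ k ω)} ≤ Real.exp (-(m * (1 - 2 * c) ^ 2 / 2)) := by
  have hZ : 0 < ∑ σ, φ ^ kemenyDist σ₀ σ :=
    Finset.sum_pos (fun σ _ => by positivity) ⟨σ₀, Finset.mem_univ _⟩
  have hmean : ∀ k, P[fun ω => U (σ k ω)] ≤ c := fun k => by
    have h := (hlaw k).integral_comp (f := U) (measurable_of_finite U).aestronglyMeasurable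
    rw [show (fun ω => U (σ k ω)) = U ∘ σ k from rfl, h, integral_gmm hφ, div_le_iff₀ hZ]
    exact hU
  have hsub : ∀ k ∈ (Finset.univ : Finset (Fin m)),
      HasSubgaussianMGF (fun ω => U (σ k ω) - P[fun ω => U (σ k ω)]) ((‖(1 : ℝ) - 0‖₊ / 2) ^ 2) P :=
    fun k _ => hasSubgaussianMGF_of_mem_Icc
      ((measurable_of_finite U).comp_aemeasurable (hlaw k).aemeasurable)
      (Filter.Eventually.of_forall fun ω => ⟨hU0 _, hU1 _⟩)
  have hind : ∀ e : Fin m → ℝ, iIndepFun (fun k ω => U (σ k ω) - e k) P := fun e =>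
    hindep.comp (fun k τ => U τ - e k) fun k => measurable_of_finite _
  have hε : 0 ≤ (m : ℝ) * (1 / 2 - c) := mul_nonneg (Nat.cast_nonneg _) (by linarith)
  refine (measureReal_mono fun ω hω => ?_).trans
    ((HasSubgaussianMGF.measure_sum_ge_le_of_iIndepFun (hind _) hsub hε).trans_eq ?_)
  · rw [Set.mem_ofPred_eq] at hω ⊢
    have : ∑ k : Fin m, P[fun ω => U (σ k ω)] ≤ m * c := by
      refine (Finset.sum_le_sum fun k _ => hmean k).trans_eq ?_
      simp
    rw [Finset.sum_sub_distrib]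
    linarith
  · congr 1
    simp only [Finset.sum_const, Finset.card_univ, Fintype.card_fin, nsmul_eq_mul]
    norm_num
    rcases Nat.eq_zero_or_pos m with rfl | hm
    · simp
    · have : (m : ℝ) ≠ 0 := by positivity
      field_simp
      ring

theorem theorem4p6 {Ω : Type*} [MeasurableSpace Ω] (P : Measure Ω) [IsProbabilityMeasure P]
    (n m : ℕ) (σ₀ : PartialRanking n) (φ δ q' : ℝ)
    (hφ : 0 < φ) (hφ1 : φ + φ ^ (1 / 2 : ℝ) < 1) (hδ : 0 < δ)
    (hq' : q' = 1 - 1 / 2 * φ ^ (1 / 2 : ℝ) - 1 / 2 * φ)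
    (σ : Fin m → Ω → PartialRanking n)
    (hlaw : ∀ k, HasLaw (σ k) (gmm σ₀ φ) P)
    (hindep : iIndepFun σ P)
    (hm : 2 / (1 - 2 * q') ^ 2 * Real.log (2 * n / δ) ≤ m) :
    1 - δ ≤ P.real {ω | lcaMedian (fun k => σ k ω) ∈ tieBreakings σ₀} := by
  obtain ⟨c, hc⟩ : ∃ c, c = 1 / 2 * φ ^ (1 / 2 : ℝ) + 1 / 2 * φ := ⟨_, rfl⟩
  have hc1 : c < 1 / 2 := by rw [hc]; linarith
  have hqc : (1 - 2 * q') ^ 2 = (1 - 2 * c) ^ 2 := by rw [hq', hc]; ring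
  have hsq : 0 < (1 - 2 * c) ^ 2 := pow_pos (by linarith) 2
  rcases Nat.eq_zero_or_pos n with rfl | hn
  · have : {ω | lcaMedian (fun k => σ k ω) ∈ tieBreakings σ₀} = Set.univ :=
      Set.eq_univ_of_forall fun ω x => x.elim0
    rw [this, probReal_univ]
    linarith
  have hn' : (0 : ℝ) < n := by exact_mod_cast hn
  have hexp : Real.exp (-(m * (1 - 2 * c) ^ 2 / 2)) ≤ δ / (2 * n) := by
    rw [hqc, div_mul_eq_mul_div, div_le_iff₀ hsq] at hm
    have h : Real.log (2 * n / δ) ≤ m * (1 - 2 * c) ^ 2 / 2 := by linarith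
    rw [← neg_le_neg_iff, ← Real.log_inv, inv_div] at h
    exact (Real.exp_le_exp.2 h).trans_eq (Real.exp_log (by positivity))
  rcases Nat.eq_zero_or_pos m with rfl | hm0
  -- An empty sample satisfies the bound on `m` only if `δ ≥ 2n`, and then the claim is trivial.
  · have : 1 ≤ δ / (2 * n) := by simpa using hexp
    rw [le_div_iff₀ (by positivity)] at this
    have h1 : (1 : ℝ) ≤ n := by exact_mod_cast hn
    exact le_trans (by linarith) measureReal_nonneg
  let A : Fin n → Set Ω := fun x =>
    {ω | (m : ℝ) / 2 ≤ ∑ k, ∑ y ∈ Finset.range (x - weakCode σ₀.1 x), vote (σ k ω) x y}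
  let B : Fin n → Set Ω := fun x => {ω | (m : ℝ) / 2 ≤
    ∑ k, (1 - ∑ y ∈ Finset.range (x - strictCode σ₀.1 x + 1), vote (σ k ω) x y)}
  have hw : ∀ τ, 0 ≤ φ ^ kemenyDist σ₀ τ := fun τ => by positivity
  have hA : ∀ x, P.real (A x) ≤ δ / (2 * n) := fun x => by
    refine (measure_half_le_sum_le hφ hlaw hindep hc1.le
      (U := fun τ => ∑ y ∈ Finset.range (x - weakCode σ₀.1 x), vote τ x y)
      (fun τ => Finset.sum_nonneg fun y _ => vote_nonneg _ _ _)
      (fun τ => sum_vote_le_one _ _ _) ?_).trans hexp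
    rw [hc]
    exact (Finset.sum_le_sum fun τ _ => mul_le_mul_of_nonneg_left
      (sum_vote_before_le σ₀ τ x) (hw τ)).trans (sum_mul_displacement_le hφ hφ1 σ₀ x)
  have hB : ∀ x, P.real (B x) ≤ δ / (2 * n) := fun x => by
    refine (measure_half_le_sum_le hφ hlaw hindep hc1.le
      (U := fun τ => 1 - ∑ y ∈ Finset.range (x - strictCode σ₀.1 x + 1), vote τ x y)
      (fun τ => sub_nonneg.2 (sum_vote_le_one _ _ _))
      (fun τ => sub_le_self _ (Finset.sum_nonneg fun y _ => vote_nonneg _ _ _)) ?_).trans hexp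
    rw [hc]
    exact (Finset.sum_le_sum fun τ _ => mul_le_mul_of_nonneg_left
      (one_sub_sum_vote_le σ₀ τ x) (hw τ)).trans (sum_mul_displacement_reverse_le hφ hφ1 σ₀ x)
  have hbad : P.real (⋃ x, A x ∪ B x) ≤ δ := by
    refine (measureReal_iUnion_fintype_le _).trans ?_
    calc ∑ x, P.real (A x ∪ B x) ≤ ∑ _x : Fin n, (δ / (2 * n) + δ / (2 * n)) :=
          Finset.sum_le_sum fun x _ => (measureReal_union_le _ _).trans (add_le_add (hA x) (hB x))
      _ = δ := by
          rw [Finset.sum_const, Finset.card_univ, Fintype.card_fin, nsmul_eq_mul]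
          field_simp
          ring
  -- Covering the space and using subadditivity, instead of taking complements, avoids any
  -- measurability of the events.
  have hcover : {ω | lcaMedian (fun k => σ k ω) ∈ tieBreakings σ₀} ∪ (⋃ x, A x ∪ B x) =
      Set.univ := by
    refine Set.eq_univ_of_forall fun ω => ?_
    by_cases hω : ω ∈ ⋃ x, A x ∪ B x
    · exact Or.inr hω
    · simp only [Set.mem_iUnion, Set.mem_union, not_exists, not_or, A, B, Set.mem_ofPred_eq,
        not_le] at hω
      exact Or.inl (lcaMedian_mem_tieBreakings hm0 σ₀ _ (fun x => (hω x).1) fun x => (hω x).2)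
  have hone := measureReal_union_le (μ := P)
    {ω | lcaMedian (fun k => σ k ω) ∈ tieBreakings σ₀} (⋃ x, A x ∪ B x)
  rw [hcover, probReal_univ] at hone
  linarith
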